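/- Let $d\ge 1$ be an integer. The equation $x^d=x^{d-1}+1$ has exactly one positive real solution $\psi$, and $\psi>1$. Moreover: (1) If $(a_n)_{n\ge1}$ is a non-decreasing sequence of positive integers with $\lim_{n\to\infty} a_n^{1/\psi^n}=\infty$, then the series $$\sum_{n=1}^\infty \frac{1}{a_n a_{n+1}\cdots a_{n+d-1}}$$ converges and its sum is irrational. (2) For every real $C>1$ there is a strictly increasing sequence $(a_n)_{n\ge1}$ of positive integers with $\lim_{n\to\infty} a_n^{1/\psi^n}=C$ for which the series $\sum_{n=1}^\infty \frac{1}{a_n a_{n+1}\cdots a_{n+d-1}}$ converges to a rational number. For $d=2$ the number $\psi$ is the golden ratio $(1+\sqrt5)/2$. The question of Erdős and Graham has a positive answer: if $a_1<a_2<\cdots$ are positive integers with $\liminf_{n\to\infty} a_n^{1/2^n}>1$ (the value $\infty$ being allowed), then $\sum_{n=1}^\infty \frac1{a_na_{n+1}}$ converges and its sum is irrational. -/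

import Mathlib

open Filter Topology

/-- `consecutiveTerm d a n` is the real number `1 / (a_n * a_{n+1} * ⋯ * a_{n+d-1})`. -/
noncomputable def consecutiveTerm (d : ℕ) (a : ℕ → ℕ) (n : ℕ) : ℝ :=
  1 / ∏ j ∈ Finset.range d, (a (n + j) : ℝ)

/-- The series `∑_{n ≥ 1} 1 / (a_n * a_{n+1} * ⋯ * a_{n+d-1})` converges and its sum is `S`.
Sequences `a_1, a_2, …` are functions on `ℕ` whose value at `0` is never used. -/
def ConsecutiveSum (d : ℕ) (a : ℕ → ℕ) (S : ℝ) : Prop :=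
  HasSum (fun n : ℕ => consecutiveTerm d a (n + 1)) S

/-! Write `d = e + 1`. For irrationality, suppose the sum is `p/q`. Multiplying the tail after `N`
terms by `q * a_1 ⋯ a_{N+e}` gives a positive integer, so the tail cannot be too small: some `i` has
`a_{N+1+e+i} ≤ q * a_1 ⋯ a_N * 2^(i+1)` (`exists_le_of_consecutiveSum_rat`). For `T N = log (a_1 ⋯
a_N)` this reads `T (N+e+1) ≤ T (N+e) + T N + O(√(T N))`, the recursion of `ψ ^ N` up to a small
error. Hence `T N = O(ψ ^ N)` (`exists_le_mul_pow_of_recursion`), against the growth hypothesis.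

For sharpness, `c n = C ^ (ψ ^ n)` satisfies `c (n+1+e) = c (n+e) * c n`. A rational remainder is
prescribed and the `a_n` are chosen greedily within constant factors of `c n`, so that the
normalised remainders stay comparable to `1 / c` and tend to zero (`exists_greedy_sequence`). The
series then telescopes to a rational number (`exists_rat_consecutiveSum`).

The Erdős–Graham question follows from the case `d = 2`, because the golden ratio is less than `2`.
-/

/-! ### The root `ψ` -/

theorem pow_mul_sub_one_eq_one_iff (e : ℕ) (x : ℝ) :
    x ^ (e + 1) = x ^ e + 1 ↔ x ^ e * (x - 1) = 1 := by
  rw [pow_succ]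
  constructor <;> intro h <;> linarith

theorem one_lt_of_pow_mul_sub_one {e : ℕ} {x : ℝ} (hx : 0 < x) (h : x ^ e * (x - 1) = 1) :
    1 < x := by
  by_contra hle
  have : x ^ e * (x - 1) ≤ 0 :=
    mul_nonpos_of_nonneg_of_nonpos (pow_nonneg hx.le e) (by linarith)
  linarith

theorem pow_mul_sub_one_lt {e : ℕ} {x y : ℝ} (hx : 1 < x) (hxy : x < y) :
    x ^ e * (x - 1) < y ^ e * (y - 1) := by
  have h1 : x ^ e ≤ y ^ e := pow_le_pow_left₀ (by linarith) hxy.le e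
  have h2 : 0 < x ^ e := pow_pos (by linarith) e
  nlinarith

/-- Positive roots exceed `1`, and `x ^ e * (x - 1)` increases strictly there, passing `1` on `[1,
2]`. -/
theorem existsUnique_root (e : ℕ) : ∃! x : ℝ, 0 < x ∧ x ^ (e + 1) = x ^ e + 1 := by
  have hc : ContinuousOn (fun x : ℝ => x ^ e * (x - 1)) (Set.Icc 1 2) := by fun_prop
  have h1 : (1 : ℝ) ∈ Set.Icc ((1 : ℝ) ^ e * (1 - 1)) (2 ^ e * (2 - 1)) := by
    have : (1 : ℝ) ≤ 2 ^ e := one_le_pow₀ (by norm_num)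
    constructor <;> norm_num
    exact this
  obtain ⟨x, hx, hfx⟩ := intermediate_value_Icc (by norm_num) hc h1
  have hx1 : 1 < x := one_lt_of_pow_mul_sub_one (by linarith [hx.1]) hfx
  refine ⟨x, ⟨by linarith, (pow_mul_sub_one_eq_one_iff e x).2 hfx⟩, ?_⟩
  rintro y ⟨hy, hfy⟩
  rw [pow_mul_sub_one_eq_one_iff] at hfy
  have hy1 := one_lt_of_pow_mul_sub_one hy hfy
  have hfx' : x ^ e * (x - 1) = 1 := hfx
  rcases lt_trichotomy x y with h | h | h
  · linarith [pow_mul_sub_one_lt (e := e) hx1 h]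
  · exact h.symm
  · linarith [pow_mul_sub_one_lt (e := e) hy1 h]

/-! ### Growth under a perturbed recursion -/

/-- A sequence satisfying the recursion of `ψ ^ n` up to a square-root error is `O(ψ ^ n)`. -/
theorem exists_le_mul_pow_of_recursion {e : ℕ} {ψ : ℝ} (hψ1 : 1 < ψ)
    (hψ : ψ ^ (e + 1) = ψ ^ e + 1) {S : ℕ → ℝ} (hS : ∀ n, 0 ≤ S n) {D : ℝ} {N₀ : ℕ}
    (hrec : ∀ N, N₀ ≤ N → S (N + (e + 1)) ≤ S (N + e) + S N + D * √(S N)) (hD : 0 ≤ D) :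
    ∃ K : ℝ, ∀ n, S n ≤ K * ψ ^ n := by
  set ρ := √ψ with hρ
  have hρ2 : ρ ^ 2 = ψ := Real.sq_sqrt (by linarith)
  have hρ1 : 1 < ρ := by rw [hρ]; exact Real.lt_sqrt_of_sq_lt (by simpa using hψ1)
  have hρψ : ρ < ψ := by nlinarith
  have hκ : 0 < 1 - ρ ^ e * (ρ - 1) := by
    have := pow_mul_sub_one_lt (e := e) hρ1 hρψ
    rw [(pow_mul_sub_one_eq_one_iff e ψ).1 hψ] at this
    linarith
  set κ := 1 - ρ ^ e * (ρ - 1) with hκdef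
  have hsum : ∀ n, n < N₀ + (e + 1) → S n ≤ ∑ i ∈ Finset.range (N₀ + (e + 1)), S i :=
    fun n hn => Finset.single_le_sum (fun i _ => hS i) (Finset.mem_range.2 hn)
  have hsum0 : 0 ≤ ∑ i ∈ Finset.range (N₀ + (e + 1)), S i := Finset.sum_nonneg fun i _ => hS i
  set B := ∑ i ∈ Finset.range (N₀ + (e + 1)), S i
  -- The summand `B` covers the initial values, and `D / κ` ensures `D ≤ t * κ`.
  set t : ℝ := 1 + B + D / κ with ht
  have hDκ : 0 ≤ D / κ := by positivity
  have htκ : D ≤ t * κ := by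
    have : D / κ * κ = D := div_mul_cancel₀ _ hκ.ne'
    nlinarith
  have hpow : ∀ n, ρ ^ n ≤ ψ ^ n := fun n => pow_le_pow_left₀ (by linarith) hρψ.le n
  -- Since `ρ < ψ`, the term `-ρ ^ n` gives the majorant a surplus `2 * t ^ 2 * κ * ρ ^ N` in the
  -- recursion. This absorbs the error, as `√(S N)` is of order `ρ ^ N`.
  have hV : ∀ n, S n ≤ 2 * t ^ 2 * (2 * ψ ^ n - ρ ^ n) := by
    intro n
    induction n using Nat.strong_induction_on with
    | _ n ih =>
      by_cases hn : n < N₀ + (e + 1)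
      · have h1 : (1 : ℝ) ≤ ψ ^ n := one_le_pow₀ hψ1.le
        have h2 := hpow n
        have h3 : B ≤ 2 * t ^ 2 := by nlinarith
        have h4 : 2 * t ^ 2 * 1 ≤ 2 * t ^ 2 * (2 * ψ ^ n - ρ ^ n) :=
          mul_le_mul_of_nonneg_left (by linarith) (by positivity)
        linarith [hsum n hn]
      · obtain ⟨N, rfl⟩ : ∃ N, n = N + (e + 1) := ⟨n - (e + 1), by omega⟩
        have h1 := ih N (by omega)
        have h2 := ih (N + e) (by omega)
        have h3 := hrec N (by omega)
        have hρN : 0 < ρ ^ N := pow_pos (by linarith) N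
        have h4 : √(S N) ≤ 2 * t * ρ ^ N := by
          apply Real.sqrt_le_iff.2
          refine ⟨by positivity, h1.trans ?_⟩
          have h5 : (2 * t * ρ ^ N) ^ 2 = 2 * t ^ 2 * (2 * ψ ^ N) := by
            rw [← hρ2]; ring
          rw [h5]
          exact mul_le_mul_of_nonneg_left (by linarith) (by positivity)
        have h6 : D * √(S N) ≤ t * κ * (2 * t * ρ ^ N) :=
          mul_le_mul htκ h4 (Real.sqrt_nonneg _) (by positivity)
        have h7 : 2 * t ^ 2 * (2 * ψ ^ (N + (e + 1)) - ρ ^ (N + (e + 1))) =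
            2 * t ^ 2 * (2 * ψ ^ (N + e) - ρ ^ (N + e)) + 2 * t ^ 2 * (2 * ψ ^ N - ρ ^ N)
              + t * κ * (2 * t * ρ ^ N) := by
          rw [pow_add ψ N (e + 1), hψ, hκdef]; ring
        linarith
  refine ⟨4 * t ^ 2, fun n => (hV n).trans ?_⟩
  have : 0 < ρ ^ n := pow_pos (by linarith) n
  nlinarith [sq_nonneg t, mul_nonneg (sq_nonneg t) this.le]

/-! ### Clearing denominators and irrationality -/

theorem consecutiveTerm_pos {a : ℕ → ℕ} (ha : ∀ n, 1 ≤ n → 0 < a n) (d : ℕ) {n : ℕ} (hn : 1 ≤ n) :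
    0 < consecutiveTerm d a n :=
  one_div_pos.2 <| Finset.prod_pos fun j _ => by exact_mod_cast ha (n + j) (by omega)

theorem prod_consecutive_dvd (a : ℕ → ℕ) {e i N : ℕ} (hi : i < N) :
    ∏ j ∈ Finset.range (e + 1), a (i + 1 + j) ∣ ∏ k ∈ Finset.range (N + e), a (k + 1) := by
  have h1 : ∏ j ∈ Finset.range (e + 1), a (i + 1 + j)
      = ∏ k ∈ Finset.Ico i (i + e + 1), a (k + 1) := by
    rw [Finset.prod_Ico_eq_prod_range, show i + e + 1 - i = e + 1 by omega]
    exact Finset.prod_congr rfl fun j _ => by congr 1; ring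
  rw [h1]
  refine Finset.prod_dvd_prod_of_subset _ _ _ fun k hk => ?_
  simp only [Finset.mem_Ico, Finset.mem_range] at hk ⊢
  omega

theorem exists_int_eq_prod_mul_partial_sum {a : ℕ → ℕ} (ha : ∀ n, 1 ≤ n → 0 < a n) (e N : ℕ) :
    ∃ z : ℤ, (∏ k ∈ Finset.range (N + e), (a (k + 1) : ℝ)) *
      ∑ i ∈ Finset.range N, consecutiveTerm (e + 1) a (i + 1) = z := by
  have h : ∀ i ∈ Finset.range N, ∃ z : ℤ, (∏ k ∈ Finset.range (N + e), (a (k + 1) : ℝ)) *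
      consecutiveTerm (e + 1) a (i + 1) = z := by
    intro i hi
    obtain ⟨c, hc⟩ := prod_consecutive_dvd a (e := e) (Finset.mem_range.1 hi)
    refine ⟨c, ?_⟩
    have hc' : (∏ k ∈ Finset.range (N + e), (a (k + 1) : ℝ)) =
        (∏ j ∈ Finset.range (e + 1), (a (i + 1 + j) : ℝ)) * c := by exact_mod_cast hc
    have hne : (∏ j ∈ Finset.range (e + 1), (a (i + 1 + j) : ℝ)) ≠ 0 :=
      Finset.prod_ne_zero_iff.2 fun j _ => by
        have := ha (i + 1 + j) (by omega)
        positivity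
    rw [hc', consecutiveTerm]
    field_simp
    simp
  choose! z hz using h
  exact ⟨∑ i ∈ Finset.range N, z i, by
    rw [Finset.mul_sum, Finset.sum_congr rfl hz]; push_cast; rfl⟩

/-- By monotonicity the `e` extra factors `a_{N+1}, …, a_{N+e}` are at most the first `e` factors of
the term's denominator; only its last factor survives. -/
theorem prod_mul_consecutiveTerm_le {a : ℕ → ℕ} (ha : ∀ n, 1 ≤ n → 0 < a n)
    (hm : MonotoneOn a (Set.Ici 1)) (e N i : ℕ) :
    (∏ k ∈ Finset.range (N + e), (a (k + 1) : ℝ)) * consecutiveTerm (e + 1) a (i + N + 1) ≤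
      (∏ k ∈ Finset.range N, (a (k + 1) : ℝ)) / a (N + 1 + e + i) := by
  have hpos : ∀ n, 0 < (a (n + 1) : ℝ) := fun n => by exact_mod_cast ha (n + 1) (by omega)
  rw [Finset.prod_range_add, consecutiveTerm, Finset.prod_range_succ,
    show i + N + 1 + e = N + 1 + e + i by ring]
  have h1 : ∏ k ∈ Finset.range e, (a (N + k + 1) : ℝ) ≤
      ∏ k ∈ Finset.range e, (a (i + N + 1 + k) : ℝ) := by
    refine Finset.prod_le_prod (fun k _ => (hpos _).le) fun k _ => ?_
    exact_mod_cast hm (by simp) (by simp; omega) (by omega)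
  have h2 : 0 < ∏ k ∈ Finset.range N, (a (k + 1) : ℝ) := Finset.prod_pos fun k _ => hpos k
  have h3 : 0 < ∏ k ∈ Finset.range e, (a (i + N + 1 + k) : ℝ) :=
    Finset.prod_pos fun k _ => by
      rw [show i + N + 1 + k = i + N + k + 1 by ring]; exact hpos _
  have h4 : 0 < (a (N + 1 + e + i) : ℝ) := by
    rw [show N + 1 + e + i = N + e + i + 1 by ring]; exact hpos _
  rw [mul_one_div, div_le_div_iff₀ (by positivity) h4]
  have := mul_le_mul_of_nonneg_left h1 (mul_pos h2 h4).le
  linarith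

/-- If the series has a rational sum then some later term is bounded by the common denominator. -/
theorem exists_le_of_consecutiveSum_rat {e : ℕ} {a : ℕ → ℕ} (ha : ∀ n, 1 ≤ n → 0 < a n)
    (hm : MonotoneOn a (Set.Ici 1)) {r : ℚ} (hr : ConsecutiveSum (e + 1) a (r : ℝ)) (N : ℕ) :
    ∃ i, (a (N + 1 + e + i) : ℝ) ≤
      r.den * (∏ k ∈ Finset.range N, (a (k + 1) : ℝ)) * 2 ^ (i + 1) := by
  by_contra! hcon
  have hpos : ∀ n, 0 < (a (n + 1) : ℝ) := fun n => by exact_mod_cast ha (n + 1) (by omega)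
  set A := ∏ k ∈ Finset.range N, (a (k + 1) : ℝ) with hA
  set A' := ∏ k ∈ Finset.range (N + e), (a (k + 1) : ℝ) with hA'
  have hApos : 0 < A := Finset.prod_pos fun k _ => hpos k
  have hA'pos : 0 < A' := Finset.prod_pos fun k _ => hpos k
  have hq : (0 : ℝ) < r.den := by exact_mod_cast r.den_pos
  have htail := ((hasSum_nat_add_iff' N).2 hr).mul_left (r.den * A')
  obtain ⟨z, hz⟩ := exists_int_eq_prod_mul_partial_sum ha e N
  have hgeo : HasSum (fun i : ℕ => (1 / 2 : ℝ) / 2 ^ i) 1 := by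
    simpa using hasSum_geometric_two' (1 : ℝ)
  have hle : ∀ i, r.den * A' * consecutiveTerm (e + 1) a (i + N + 1) < (1 / 2 : ℝ) / 2 ^ i := by
    intro i
    have h1 := prod_mul_consecutiveTerm_le ha hm e N i
    have h2 := hcon i
    have h4 : 0 < (a (N + 1 + e + i) : ℝ) := by
      rw [show N + 1 + e + i = N + e + i + 1 by ring]; exact hpos _
    calc r.den * A' * consecutiveTerm (e + 1) a (i + N + 1)
        = r.den * (A' * consecutiveTerm (e + 1) a (i + N + 1)) := by ring
      _ ≤ r.den * (A / a (N + 1 + e + i)) := mul_le_mul_of_nonneg_left h1 hq.le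
      _ < (1 / 2 : ℝ) / 2 ^ i := by
        rw [← mul_div_assoc, div_div, div_lt_div_iff₀ h4 (by positivity)]
        rw [pow_succ] at h2
        linarith
  have hlt : r.den * A' * (r - ∑ i ∈ Finset.range N, consecutiveTerm (e + 1) a (i + 1)) < (1 : ℝ) :=
    hasSum_lt (fun i => (hle i).le) (hle 0) htail hgeo
  have hgt : 0 < r.den * A' * (r - ∑ i ∈ Finset.range N, consecutiveTerm (e + 1) a (i + 1)) :=
    hasSum_lt (f := fun _ => (0 : ℝ)) (i := 0)
      (fun i => (mul_pos (mul_pos hq hA'pos) (consecutiveTerm_pos ha _ (by omega))).le)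
      (mul_pos (mul_pos hq hA'pos) (consecutiveTerm_pos ha _ (by omega))) hasSum_zero htail
  have hint : r.den * A' * (r - ∑ i ∈ Finset.range N, consecutiveTerm (e + 1) a (i + 1)) =
      ((r.num * (∏ k ∈ Finset.range (N + e), (a (k + 1) : ℤ)) - r.den * z : ℤ) : ℝ) := by
    have hrd : (r.den : ℝ) * r = r.num := by exact_mod_cast r.den_mul_eq_num
    push_cast
    rw [← hz, ← hrd]
    ring
  -- The cleared tail is an integer strictly between `0` and `1`.
  rw [hint] at hlt hgt
  have h1 : r.num * (∏ k ∈ Finset.range (N + e), (a (k + 1) : ℤ)) - r.den * z < 1 := by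
    exact_mod_cast hlt
  have h2 : 0 < r.num * (∏ k ∈ Finset.range (N + e), (a (k + 1) : ℤ)) - r.den * z := by
    exact_mod_cast hgt
  omega

theorem eventually_mul_pow_le_log {ψ : ℝ} (hψ : 0 < ψ) {a : ℕ → ℕ} (ha : ∀ n, 1 ≤ n → 0 < a n)
    (h : Tendsto (fun n : ℕ => (a n : ℝ) ^ ((1 : ℝ) / ψ ^ n)) atTop atTop) (K : ℝ) :
    ∀ᶠ n in atTop, K * ψ ^ n ≤ Real.log (a n) := by
  filter_upwards [h.eventually_ge_atTop (Real.exp K), eventually_ge_atTop 1] with n hn h1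
  have hpos : 0 < (a n : ℝ) := by exact_mod_cast ha n h1
  have := Real.log_le_log (Real.exp_pos K) hn
  rw [Real.log_exp, Real.log_rpow hpos, one_div, inv_mul_eq_div,
    le_div_iff₀ (pow_pos hψ n)] at this
  exact this

theorem eventually_sq_le_log {ψ : ℝ} (hψ : 1 < ψ) {a : ℕ → ℕ} (ha : ∀ n, 1 ≤ n → 0 < a n)
    (h : Tendsto (fun n : ℕ => (a n : ℝ) ^ ((1 : ℝ) / ψ ^ n)) atTop atTop) :
    ∀ᶠ n : ℕ in atTop, (n : ℝ) ^ 2 ≤ Real.log (a n) := by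
  have h1 := (tendsto_pow_const_div_const_pow_of_one_lt 2 hψ).eventually_le_const
    (show (0 : ℝ) < 1 by norm_num)
  filter_upwards [h1, eventually_mul_pow_le_log (by linarith) ha h 1] with n hn h2
  rw [div_le_one (by positivity)] at hn
  linarith

theorem exists_consecutiveSum {a : ℕ → ℕ} (ha : ∀ n, 1 ≤ n → 0 < a n)
    (h : ∀ᶠ n : ℕ in atTop, (n : ℝ) ^ 2 ≤ Real.log (a n)) (e : ℕ) :
    ∃ S, ConsecutiveSum (e + 1) a S := by
  have hs : Summable fun n : ℕ => consecutiveTerm (e + 1) a n := by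
    refine Summable.of_norm_bounded_eventually_nat
      (Real.summable_one_div_nat_pow.2 (by norm_num : 1 < 2)) ?_
    filter_upwards [h, eventually_ge_atTop 1] with n hn h1
    have hpos : ∀ j, 1 ≤ (a (n + j) : ℝ) := fun j => by exact_mod_cast ha (n + j) (by omega)
    rw [Real.norm_of_nonneg (consecutiveTerm_pos ha _ h1).le]
    have h2 : (n : ℝ) ^ 2 ≤ a n := by
      have := Real.log_le_sub_one_of_pos (show 0 < (a n : ℝ) by exact_mod_cast ha n h1)
      linarith
    have hn0 : (0 : ℝ) < n := by exact_mod_cast h1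
    refine one_div_le_one_div_of_le (by positivity) ?_
    rw [Finset.prod_range_succ']
    have h3 : 1 ≤ ∏ k ∈ Finset.range e, (a (n + (k + 1)) : ℝ) :=
      Finset.prod_const_one.symm.le.trans
        (Finset.prod_le_prod (fun _ _ => zero_le_one) fun k _ => hpos (k + 1))
    simp only [add_zero]
    nlinarith [hpos 0]
  exact ⟨_, ((summable_nat_add_iff 1).2 hs).hasSum⟩

theorem irrational_of_consecutiveSum {e : ℕ} {ψ : ℝ} (hψ1 : 1 < ψ)
    (hψ : ψ ^ (e + 1) = ψ ^ e + 1) {a : ℕ → ℕ} (ha : ∀ n, 1 ≤ n → 0 < a n)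
    (hm : MonotoneOn a (Set.Ici 1))
    (h : Tendsto (fun n : ℕ => (a n : ℝ) ^ ((1 : ℝ) / ψ ^ n)) atTop atTop) {S : ℝ}
    (hS : ConsecutiveSum (e + 1) a S) : Irrational S := by
  rintro ⟨r, rfl⟩
  have hpos : ∀ n, 1 ≤ n → 0 < (a n : ℝ) := fun n hn => by exact_mod_cast ha n hn
  obtain ⟨N₁, hN₁⟩ := eventually_atTop.1 (eventually_sq_le_log hψ1 ha h)
  set c := Real.log r.den with hc
  have hden : (1 : ℝ) ≤ r.den := by exact_mod_cast r.den_pos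
  have hc0 : 0 ≤ c := Real.log_nonneg hden
  have hL0 : ∀ n, 0 ≤ Real.log (a (n + 1)) := fun n =>
    Real.log_nonneg (by exact_mod_cast ha (n + 1) (by omega))
  set T : ℕ → ℝ := fun N => ∑ k ∈ Finset.range N, Real.log (a (k + 1)) with hT
  have hT0 : ∀ N, 0 ≤ T N := fun N => Finset.sum_nonneg fun k _ => hL0 k
  have hTsucc : ∀ N, T (N + 1) = T N + Real.log (a (N + 1)) :=
    fun N => Finset.sum_range_succ _ _
  have hrec : ∀ N, N₁ + 1 ≤ N → T (N + (e + 1)) ≤ T (N + e) + T N + (3 * c + 3) * √(T N) := by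
    intro N hN
    obtain ⟨i, hi⟩ := exists_le_of_consecutiveSum_rat ha hm hS N
    have hprod : 0 < ∏ k ∈ Finset.range N, (a (k + 1) : ℝ) :=
      Finset.prod_pos fun k _ => hpos _ (by omega)
    have h1 := Real.log_le_log (hpos _ (by omega)) hi
    rw [Real.log_mul (by positivity) (by positivity), Real.log_mul (by positivity) hprod.ne',
      Real.log_prod (fun k _ => (hpos _ (by omega)).ne'), Real.log_pow] at h1
    change _ ≤ c + T N + _ at h1
    set m := N + 1 + e + i with hmdef
    have h2 : ((i + 1 : ℕ) : ℝ) * Real.log 2 ≤ m := by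
      have h3 : ((i + 1 : ℕ) : ℝ) ≤ m := by exact_mod_cast (by omega)
      have h4 := Real.log_two_lt_d9
      have h5 := Real.log_pos one_lt_two
      have h6 : (0 : ℝ) ≤ ((i + 1 : ℕ) : ℝ) := by positivity
      nlinarith
    have h3 : (m : ℝ) ^ 2 ≤ Real.log (a m) := hN₁ m (by omega)
    have hTN : 1 ≤ T N := by
      obtain ⟨M, rfl⟩ : ∃ M, N = M + 1 := ⟨N - 1, by omega⟩
      have h4 := hN₁ (M + 1) (by omega)
      have h5 := hT0 M
      have h6 : (1 : ℝ) ≤ ((M + 1 : ℕ) : ℝ) := by exact_mod_cast (by omega)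
      rw [hTsucc]
      nlinarith
    have hs1 : 1 ≤ √(T N) := Real.one_le_sqrt.2 hTN
    have hs2 : √(T N) ^ 2 = T N := Real.sq_sqrt (hT0 N)
    have h7 : (m : ℝ) ^ 2 ≤ ((2 * c + 3) * √(T N)) ^ 2 := by
      rw [mul_pow, hs2]
      -- From `m ^ 2 ≤ c + T N + m` and `2 * m ≤ m ^ 2 + 1`, using `1 ≤ T N`. So the unknown shift
      -- `i` costs only `O(√(T N))`.
      have h8 : (m : ℝ) ^ 2 ≤ (2 * c + 3) * T N := by nlinarith [sq_nonneg ((m : ℝ) - 1)]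
      nlinarith [mul_nonneg hc0 (hT0 N), mul_nonneg (mul_nonneg hc0 hc0) (hT0 N)]
    have h8 : (m : ℝ) ≤ (2 * c + 3) * √(T N) := by
      exact le_of_sq_le_sq h7 (by positivity)
    have h9 : Real.log (a (N + e + 1)) ≤ Real.log (a m) :=
      Real.log_le_log (hpos _ (by omega)) (by
        exact_mod_cast hm (by simp) (by simp; omega) (by omega))
    rw [← add_assoc, hTsucc]
    nlinarith
  obtain ⟨K, hK⟩ := exists_le_mul_pow_of_recursion hψ1 hψ hT0 hrec (by positivity)
  obtain ⟨n, hn, hn1⟩ := ((eventually_mul_pow_le_log (by linarith) ha h (K + 1)).and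
    (eventually_ge_atTop 1)).exists
  obtain ⟨M, rfl⟩ : ∃ M, n = M + 1 := ⟨n - 1, by omega⟩
  have h1 := hK (M + 1)
  rw [hTsucc] at h1
  have h2 := hT0 M
  have h3 : 0 < ψ ^ (M + 1) := pow_pos (by linarith) _
  linarith

theorem exists_irrational_consecutiveSum {e : ℕ} {ψ : ℝ} (hψ1 : 1 < ψ)
    (hψ : ψ ^ (e + 1) = ψ ^ e + 1) {a : ℕ → ℕ} (ha : ∀ n, 1 ≤ n → 0 < a n)
    (hm : MonotoneOn a (Set.Ici 1))
    (h : Tendsto (fun n : ℕ => (a n : ℝ) ^ ((1 : ℝ) / ψ ^ n)) atTop atTop) :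
    ∃ S : ℝ, ConsecutiveSum (e + 1) a S ∧ Irrational S := by
  obtain ⟨S, hS⟩ := exists_consecutiveSum ha (eventually_sq_le_log hψ1 ha h) e
  exact ⟨S, hS, irrational_of_consecutiveSum hψ1 hψ ha hm h hS⟩

/-! ### Greedy construction -/

/-- Rounding up overshoots the target `m * z - 1 = A / (6 * c * b)` by at most `z ≤ 1 / (4 * c)`,
which is at most `A / (12 * c * b)`. -/
theorem exists_nat_mul_sub_one_mem {c b z A : ℝ} (hc : 0 < c) (hb : 0 < b) (hz0 : 0 < z)
    (hz : z * (4 * c) ≤ 1) (hA : 3 * b ≤ A) :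
    ∃ m : ℕ, A ≤ 6 * (c * b) * (m * z - 1) ∧ 4 * (c * b) * (m * z - 1) ≤ A := by
  have hA0 : 0 < A := by linarith
  have hcb : 0 < c * b := mul_pos hc hb
  have h0 : 0 ≤ (1 + A / (6 * (c * b))) / z := by positivity
  refine ⟨⌈(1 + A / (6 * (c * b))) / z⌉₊, ?_, ?_⟩
  · have h1 := Nat.le_ceil ((1 + A / (6 * (c * b))) / z)
    rw [div_le_iff₀ hz0] at h1
    have h2 : A / (6 * (c * b)) * (6 * (c * b)) = A := div_mul_cancel₀ _ (by positivity)
    nlinarith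
  · have h1 := (Nat.ceil_lt_add_one h0).le
    have h2 := mul_le_mul_of_nonneg_right h1 hz0.le
    rw [add_mul, div_mul_cancel₀ _ hz0.ne'] at h2
    have h3 : A / (6 * (c * b)) * (6 * (c * b)) = A := div_mul_cancel₀ _ (by positivity)
    have h4 : z * (4 * c) * b ≤ 1 * b := mul_le_mul_of_nonneg_right hz hb.le
    have h5 := mul_le_mul_of_nonneg_left h2 hcb.le
    nlinarith

/-- For `e = 0` the chosen `m` is also the divisor in the remainder recursion. The proxy `A = 1 / z`
works since `1 ≤ m * z ≤ 4 / 3`; the factor `4 / 3` turns the `6` into `8`. -/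
theorem exists_nat_mul_sub_one_mem_self {c z : ℝ} (hc : 6 ≤ c) (hz0 : 0 < z)
    (hz : z * (4 * c) ≤ 1) (hz' : 1 ≤ z * (8 * c)) :
    ∃ m : ℕ, m ≤ 8 * (c * c) * (m * z - 1) ∧ 4 * (c * c) * (m * z - 1) ≤ m ∧ m * z ≤ 2 := by
  have hc0 : 0 < c := by linarith
  have hAz : 1 / z * z = 1 := div_mul_cancel₀ _ hz0.ne'
  have hA0 : 0 < 1 / z := by positivity
  set A := 1 / z
  have h4 : 4 * c ≤ A := by nlinarith
  have h8 : A ≤ 8 * c := by nlinarith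
  obtain ⟨m, h1, h2⟩ := exists_nat_mul_sub_one_mem hc0 hc0 hz0 hz (A := A) (by linarith)
  have hcc : 0 < c * c := mul_pos hc0 hc0
  have h3 : m * z - 1 ≤ 1 / 3 := by
    by_contra! hcon
    nlinarith
  have h5 : 0 ≤ m * z - 1 := by
    by_contra! hcon
    nlinarith
  have h6 : (m : ℝ) = m * z * A := by linear_combination -(m : ℝ) * hAz
  refine ⟨m, ?_, ?_, by linarith⟩ <;> nlinarith

theorem exists_update_mul_sub_one_mem {c b z : ℝ} {F : ℕ → ℕ} {N e : ℕ} (hc : 6 ≤ c) (hb : 0 < b)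
    (hcb : e = 0 → c = b) (hz0 : 0 < z) (hz : z * (4 * c) ≤ 1) (hz' : 1 ≤ z * (8 * c))
    (hF : 4 * b ≤ F N) (hF' : F N ≤ 16 * b) :
    ∃ m : ℕ, (Function.update F (N + e) m N : ℝ) ≤ 8 * (c * b) * (m * z - 1) ∧
      4 * (c * b) * (m * z - 1) ≤ Function.update F (N + e) m N ∧ m * z ≤ 2 := by
  rcases Nat.eq_zero_or_pos e with rfl | he
  · simpa [← hcb rfl] using exists_nat_mul_sub_one_mem_self hc hz0 hz hz'
  · have hc0 : 0 < c := by linarith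
    have hcb : 0 < c * b := mul_pos hc0 hb
    obtain ⟨m, h1, h2⟩ := exists_nat_mul_sub_one_mem hc0 hb hz0 hz (A := F N) (by linarith)
    refine ⟨m, ?_⟩
    rw [Function.update_of_ne (by omega)]
    have h3 : 0 ≤ m * z - 1 := by
      by_contra! hcon
      nlinarith
    refine ⟨by nlinarith, h2, ?_⟩
    by_contra! hcon
    nlinarith

/-- The states of the inductive construction: the sequence so far, with default values in the
places that are not reached yet, and the normalised remainder of the series. -/
structure IsGreedyState (c : ℕ → ℝ) (e K N : ℕ) (s : (ℕ → ℕ) × ℝ) : Prop where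
  lower : ∀ k, 4 * c k ≤ s.1 k
  upper : ∀ k, K ≤ k → s.1 k ≤ 16 * c k
  remainder_le : s.2 * (4 * c (N + e)) ≤ 1
  le_remainder : 1 ≤ s.2 * (8 * c (N + e))

theorem IsGreedyState.remainder_pos {c : ℕ → ℝ} {e K N : ℕ} {s : (ℕ → ℕ) × ℝ}
    (hc0 : ∀ n, 0 < c n) (hs : IsGreedyState c e K N s) : 0 < s.2 := by
  have h1 := hs.le_remainder
  have h2 := hc0 (N + e)
  by_contra! h
  nlinarith

theorem IsGreedyState.exists_succ {c : ℕ → ℝ} {e K N : ℕ} {s : (ℕ → ℕ) × ℝ}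
    (hc0 : ∀ n, 0 < c n) (hc6 : ∀ n, K ≤ n → 6 ≤ c n)
    (hrec : ∀ n, c (n + 1 + e) = c (n + e) * c n) (hN : K ≤ N) (hs : IsGreedyState c e K N s) :
    ∃ t, IsGreedyState c e K (N + 1) t ∧ (∀ k, k ≠ N + e → t.1 k = s.1 k) ∧
      t.2 * t.1 N = t.1 (N + e) * s.2 - 1 := by
  have hz0 := hs.remainder_pos hc0
  have hce := hc0 (N + e)
  obtain ⟨m, h1, h2, h3⟩ := exists_update_mul_sub_one_mem (e := e) (hc6 (N + e) (by omega)) (hc0 N)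
    (by rintro rfl; rfl) hz0 hs.remainder_le hs.le_remainder (hs.lower N) (hs.upper N hN)
  set F := Function.update s.1 (N + e) m with hF
  have hFm : F (N + e) = m := Function.update_self ..
  have hFne : ∀ k, k ≠ N + e → F k = s.1 k := fun k hk => Function.update_of_ne hk ..
  have hcb : 0 < c (N + e) * c N := mul_pos hce (hc0 N)
  have hpos : 0 ≤ m * s.2 - 1 := by
    have h4 : (0 : ℝ) ≤ F N := Nat.cast_nonneg _
    by_contra! hcon
    nlinarith
  have hm4 : 4 * c (N + e) ≤ m := by
    have := hs.remainder_le
    by_contra! hcon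
    nlinarith
  have hm16 : m ≤ 16 * c (N + e) := by
    have := hs.le_remainder
    by_contra! hcon
    nlinarith
  have hlow : ∀ k, 4 * c k ≤ F k := fun k => by
    by_cases hk : k = N + e
    · rw [hk, hFm]; exact hm4
    · rw [hFne k hk]; exact hs.lower k
  have hFN : (0 : ℝ) < F N := by linarith [hlow N, hc0 N]
  refine ⟨(F, (m * s.2 - 1) / F N), ⟨hlow, fun k hk' => ?_, ?_, ?_⟩, hFne, ?_⟩
  · by_cases hk : k = N + e
    · change (F k : ℝ) ≤ _
      rw [hk, hFm]; exact hm16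
    · change (F k : ℝ) ≤ _
      rw [hFne k hk]; exact hs.upper k hk'
  · rw [div_mul_eq_mul_div, div_le_one hFN, hrec]
    linarith
  · rw [div_mul_eq_mul_div, one_le_div hFN, hrec]
    linarith
  · simp only [hFm]
    exact div_mul_cancel₀ _ hFN.ne'

theorem exists_greedy_sequence {c : ℕ → ℝ} {e K : ℕ} {s₀ : (ℕ → ℕ) × ℝ}
    (hc0 : ∀ n, 0 < c n) (hc6 : ∀ n, K ≤ n → 6 ≤ c n)
    (hrec : ∀ n, c (n + 1 + e) = c (n + e) * c n) (hs₀ : IsGreedyState c e K (K + 1) s₀) :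
    ∃ (a : ℕ → ℕ) (z : ℕ → ℝ), (∀ k, k < K + 1 + e → a k = s₀.1 k) ∧ z 0 = s₀.2 ∧
      (∀ k, 4 * c k ≤ a k) ∧ (∀ k, K ≤ k → a k ≤ 16 * c k) ∧ (∀ n, 0 < z n) ∧
      (∀ n, z n * (4 * c (K + 1 + n + e)) ≤ 1) ∧
      ∀ n, z (n + 1) * a (K + 1 + n) = a (K + 1 + n + e) * z n - 1 := by
  have hstep : ∀ (N : ℕ) (s : (ℕ → ℕ) × ℝ), K ≤ N ∧ IsGreedyState c e K N s →
      ∃ t, IsGreedyState c e K (N + 1) t ∧ (∀ k, k ≠ N + e → t.1 k = s.1 k) ∧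
      t.2 * t.1 N = t.1 (N + e) * s.2 - 1 :=
    fun N s h => h.2.exists_succ hc0 hc6 hrec h.1
  choose! f hf using hstep
  set σ : ℕ → (ℕ → ℕ) × ℝ := fun n => Nat.rec s₀ (fun i s => f (K + 1 + i) s) n with hσ
  have hσs : ∀ n, σ (n + 1) = f (K + 1 + n) (σ n) := fun n => rfl
  have hinv : ∀ n, IsGreedyState c e K (K + 1 + n) (σ n) := by
    intro n
    induction n with
    | zero => exact hs₀
    | succ n ih =>
      rw [hσs]
      exact (hf _ _ ⟨by omega, ih⟩).1
  have hstab : ∀ n i k, k < K + 1 + n + e → (σ (n + i)).1 k = (σ n).1 k := by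
    intro n i k hk
    induction i with
    | zero => rfl
    | succ i ih =>
      rw [← add_assoc, hσs, (hf _ _ ⟨by omega, hinv _⟩).2.1 k (by omega), ih]
  -- Stage `n` alters only the place `K + 1 + n + e`, so place `k` is already final at stage `k` and
  -- the diagonal is the limit sequence.
  have hval : ∀ n k, k < K + 1 + n + e → (σ n).1 k = (σ k).1 k := by
    intro n k hk
    rcases le_total n k with h | h
    · obtain ⟨i, hi⟩ := Nat.exists_eq_add_of_le h
      have := hstab n i k hk
      rw [← hi] at this
      exact this.symm
    · obtain ⟨i, rfl⟩ := Nat.exists_eq_add_of_le h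
      exact hstab k i k (by omega)
  refine ⟨fun k => (σ k).1 k, fun n => (σ n).2, fun k hk => (hval 0 k (by omega)).symm, rfl,
    fun k => (hinv k).lower k, fun k hk => (hinv k).upper k hk,
    fun n => (hinv n).remainder_pos hc0, fun n => (hinv n).remainder_le, fun n => ?_⟩
  have h := (hf (K + 1 + n) (σ n) ⟨by omega, hinv n⟩).2.2
  rw [← hσs, hval (n + 1) _ (by omega), hval (n + 1) _ (by omega)] at h
  exact h

/-- A remainder recursion makes the series telescope. -/
theorem exists_rat_consecutiveSum {a : ℕ → ℕ} {z : ℕ → ℝ} {e K : ℕ} (ha : ∀ n, 0 < a n)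
    (hz : Tendsto z atTop (𝓝 0)) (hz0 : ∀ n, 0 ≤ z n) {q : ℚ} (hq : z 0 = q)
    (hrec : ∀ n, z (n + 1) * a (K + 1 + n) = a (K + 1 + n + e) * z n - 1) :
    ∃ r : ℚ, ConsecutiveSum (e + 1) a (r : ℝ) := by
  have hpos : ∀ n, (0 : ℝ) < a n := fun n => by exact_mod_cast ha n
  set R : ℕ → ℝ := fun n => z n / ∏ j ∈ Finset.range e, (a (K + 1 + n + j) : ℝ) with hR
  have hprod : ∀ n, (0 : ℝ) < ∏ j ∈ Finset.range e, (a (n + j) : ℝ) :=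
    fun n => Finset.prod_pos fun j _ => hpos _
  have hterm : ∀ n, consecutiveTerm (e + 1) a (n + K + 1) = R n - R (n + 1) := by
    intro n
    have h1 := Finset.prod_range_succ (fun j => (a (K + 1 + n + j) : ℝ)) e
    have h2 := Finset.prod_range_succ' (fun j => (a (K + 1 + n + j) : ℝ)) e
    have h3 : ∏ j ∈ Finset.range e, (a (K + 1 + n + (j + 1)) : ℝ) =
        ∏ j ∈ Finset.range e, (a (K + 1 + (n + 1) + j) : ℝ) :=
      Finset.prod_congr rfl fun j _ => by
        rw [show K + 1 + n + (j + 1) = K + 1 + (n + 1) + j by ring]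
    rw [h3, add_zero] at h2
    rw [consecutiveTerm, show n + K + 1 = K + 1 + n by ring, h1]
    have h4 := hprod (K + 1 + n)
    have h5 := hprod (K + 1 + (n + 1))
    have h6 := hpos (K + 1 + n + e)
    have h7 := hpos (K + 1 + n)
    have h8 := h1.symm.trans h2
    simp only [hR]
    set P := ∏ j ∈ Finset.range e, (a (K + 1 + n + j) : ℝ)
    set P' := ∏ j ∈ Finset.range e, (a (K + 1 + (n + 1) + j) : ℝ)
    rw [div_sub_div _ _ h4.ne' h5.ne', div_eq_div_iff (by positivity) (by positivity)]
    -- `h8` says that both sides equal the same product of `e + 1` consecutive terms.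
    linear_combination (P * P') * (hrec n) + P * z (n + 1) * h8
  have hRlim : Tendsto R atTop (𝓝 0) := by
    refine squeeze_zero (fun n => div_nonneg (hz0 n) (hprod _).le) (fun n => ?_) hz
    refine div_le_self (hz0 n) ?_
    exact Finset.prod_const_one.symm.le.trans
      (Finset.prod_le_prod (fun _ _ => zero_le_one) fun k _ => by exact_mod_cast ha _)
  have hsum : HasSum (fun n => consecutiveTerm (e + 1) a (n + K + 1)) (R 0) := by
    rw [hasSum_iff_tendsto_nat_of_nonneg
      fun n => (consecutiveTerm_pos (fun n _ => ha n) _ (by omega)).le]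
    simp only [hterm, Finset.sum_range_sub']
    simpa using hRlim.const_sub (R 0)
  have h := (hasSum_nat_add_iff (f := fun n => consecutiveTerm (e + 1) a (n + 1)) K).1 hsum
  refine ⟨q / ∏ j ∈ Finset.range e, (a (K + 1 + j) : ℚ) +
    ∑ n ∈ Finset.range K, 1 / ∏ j ∈ Finset.range (e + 1), (a (n + 1 + j) : ℚ), ?_⟩
  have heq : ((q / ∏ j ∈ Finset.range e, (a (K + 1 + j) : ℚ) +
      ∑ n ∈ Finset.range K, 1 / ∏ j ∈ Finset.range (e + 1), (a (n + 1 + j) : ℚ) : ℚ) : ℝ) =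
      R 0 + ∑ n ∈ Finset.range K, consecutiveTerm (e + 1) a (n + 1) := by
    simp [hR, hq, consecutiveTerm]
  rw [heq]
  exact h

/-! ### Doubly exponential growth -/

section Growth

variable {C ψ : ℝ}

theorem tendsto_rpow_pow_atTop (hC : 1 < C) (hψ : 1 < ψ) :
    Tendsto (fun n : ℕ => C ^ (ψ ^ n)) atTop atTop :=
  (tendsto_rpow_atTop_of_base_gt_one C hC).comp (tendsto_pow_atTop_atTop_of_one_lt hψ)

theorem eventually_add_one_le_rpow_pow (hC : 1 < C) (hψ : 1 < ψ) :
    ∀ᶠ n : ℕ in atTop, (n : ℝ) + 1 ≤ C ^ (ψ ^ n) := by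
  have hlog := Real.log_pos hC
  filter_upwards [(tendsto_pow_const_div_const_pow_of_one_lt 1 hψ).eventually_le_const hlog]
    with n hn
  rw [pow_one, div_le_iff₀ (by positivity)] at hn
  rw [Real.rpow_def_of_pos (by linarith)]
  exact (Real.add_one_le_exp _).trans (Real.exp_le_exp.2 hn)

theorem eventually_mul_rpow_pow_lt_succ (hC : 1 < C) (hψ : 1 < ψ) (B : ℝ) :
    ∀ᶠ n : ℕ in atTop, B * C ^ (ψ ^ n) < C ^ (ψ ^ (n + 1)) := by
  have h := (tendsto_rpow_atTop_of_base_gt_one C hC).comp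
    ((tendsto_pow_atTop_atTop_of_one_lt hψ).atTop_mul_const (sub_pos.2 hψ))
  filter_upwards [h.eventually_gt_atTop B] with n hn
  have h0 : 0 < C ^ (ψ ^ n) := Real.rpow_pos_of_pos (by linarith) _
  have h1 : C ^ (ψ ^ (n + 1)) = C ^ (ψ ^ n * (ψ - 1)) * C ^ (ψ ^ n) := by
    rw [← Real.rpow_add (by linarith)]; congr 1; ring
  rw [h1]
  exact mul_lt_mul_of_pos_right hn h0

/-- Constant factors disappear because `D ^ (1 / ψ ^ n)` tends to `1`. -/
theorem tendsto_rpow_inv_pow_of_bounds (hC : 0 < C) (hψ : 1 < ψ) {x : ℕ → ℝ} {A B : ℝ}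
    (hA : 0 < A) (hB : 0 < B) (hx : ∀ᶠ n : ℕ in atTop, A * C ^ (ψ ^ n) ≤ x n ∧
      x n ≤ B * C ^ (ψ ^ n)) :
    Tendsto (fun n : ℕ => x n ^ ((1 : ℝ) / ψ ^ n)) atTop (𝓝 C) := by
  have h0 : Tendsto (fun n : ℕ => (1 : ℝ) / ψ ^ n) atTop (𝓝 0) :=
    (tendsto_pow_atTop_atTop_of_one_lt hψ).const_div_atTop 1
  have hlim : ∀ D : ℝ, 0 < D →
      Tendsto (fun n : ℕ => (D * C ^ (ψ ^ n)) ^ ((1 : ℝ) / ψ ^ n)) atTop (𝓝 C) := by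
    intro D hD
    have h1 : Tendsto (fun n : ℕ => D ^ ((1 : ℝ) / ψ ^ n) * C) atTop (𝓝 (D ^ (0 : ℝ) * C)) :=
      (tendsto_const_nhds.rpow h0 (Or.inl hD.ne')).mul_const C
    rw [Real.rpow_zero, one_mul] at h1
    refine h1.congr fun n => ?_
    rw [Real.mul_rpow hD.le (by positivity), ← Real.rpow_mul hC.le,
      mul_one_div_cancel (by positivity), Real.rpow_one]
  refine tendsto_of_tendsto_of_tendsto_of_le_of_le' (hlim A hA) (hlim B hB) ?_ ?_
  · filter_upwards [hx] with n hn
    exact Real.rpow_le_rpow (by positivity) hn.1 (by positivity)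
  · filter_upwards [hx] with n hn
    exact Real.rpow_le_rpow (le_trans (by positivity) hn.1) hn.2 (by positivity)

end Growth

theorem exists_rat_consecutiveSum_of_one_lt {e : ℕ} {ψ C : ℝ} (hψ1 : 1 < ψ)
    (hψ : ψ ^ (e + 1) = ψ ^ e + 1) (hC : 1 < C) :
    ∃ a : ℕ → ℕ, (∀ n, 0 < a n) ∧ StrictMono a ∧
      Tendsto (fun n : ℕ => (a n : ℝ) ^ ((1 : ℝ) / ψ ^ n)) atTop (𝓝 C) ∧
      ∃ q : ℚ, ConsecutiveSum (e + 1) a (q : ℝ) := by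
  obtain ⟨K, hK⟩ := eventually_atTop.1 (((tendsto_rpow_pow_atTop hC hψ1).eventually_ge_atTop 6).and
    ((eventually_add_one_le_rpow_pow hC hψ1).and (eventually_mul_rpow_pow_lt_succ hC hψ1 4)))
  have hC0 : 0 < C := by linarith
  have hctop := tendsto_rpow_pow_atTop hC hψ1
  have hbound := fun x : ℕ → ℝ => tendsto_rpow_inv_pow_of_bounds (x := x) hC0 hψ1
    (show (0 : ℝ) < 4 by norm_num) (show (0 : ℝ) < 16 by norm_num)
  have hrec : ∀ n, C ^ (ψ ^ (n + 1 + e)) = C ^ (ψ ^ (n + e)) * C ^ (ψ ^ n) := by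
    intro n
    rw [← Real.rpow_add hC0, show n + 1 + e = n + (e + 1) by ring, pow_add, hψ, pow_add]
    congr 1; ring
  have hcmono : ∀ n, C ^ (ψ ^ n) < C ^ (ψ ^ (n + 1)) := fun n =>
    Real.rpow_lt_rpow_of_exponent_lt hC (pow_lt_pow_right₀ hψ1 (by omega))
  have hc0 : ∀ n : ℕ, 0 < C ^ (ψ ^ n) := fun n => Real.rpow_pos_of_pos hC0 _
  set c : ℕ → ℝ := fun n => C ^ (ψ ^ n) with hc
  -- The admissible window for the first remainder is an open interval, so a rational one fits.
  obtain ⟨q, hq1, hq2⟩ := exists_rat_btwn (show 1 / (8 * c (K + 1 + e)) < 1 / (4 * c (K + 1 + e)) by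
    have := hc0 (K + 1 + e)
    exact one_div_lt_one_div_of_lt (by positivity) (by linarith))
  -- The summand `k` makes the default values strictly increasing; `k + 1 ≤ c k` keeps them below
  -- `16 * c k` from `K` on.
  have hinit : IsGreedyState c e K (K + 1) (fun k => ⌈4 * c k⌉₊ + k, (q : ℝ)) := by
    have h8 : 0 < 8 * c (K + 1 + e) := by linarith [hc0 (K + 1 + e)]
    have h4 : 0 < 4 * c (K + 1 + e) := by linarith [hc0 (K + 1 + e)]
    refine ⟨fun k => ?_, fun k hk => ?_, ((lt_div_iff₀ h4).1 hq2).le, ((div_lt_iff₀ h8).1 hq1).le⟩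
    · push_cast
      have := Nat.le_ceil (4 * c k)
      have : (0 : ℝ) ≤ k := Nat.cast_nonneg k
      linarith
    · push_cast
      have h1 := Nat.ceil_lt_add_one (show 0 ≤ 4 * c k by linarith [hc0 k])
      have h2 : (k : ℝ) + 1 ≤ c k := (hK k hk).2.1
      linarith [hc0 k]
  obtain ⟨a, z, ha0, hz0, halow, hahigh, hzpos, hzle, hz⟩ :=
    exists_greedy_sequence hc0 (fun n hn => (hK n hn).1) hrec hinit
  have hapos : ∀ n, 0 < a n := fun n => by
    have : (0 : ℝ) < a n := by linarith [halow n, hc0 n]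
    exact_mod_cast this
  have hzlim : Tendsto z atTop (𝓝 0) := by
    have h1 : Tendsto (fun n : ℕ => 4 * c (K + 1 + n + e)) atTop atTop := by
      have h2 : Tendsto (fun n : ℕ => K + 1 + n + e) atTop atTop :=
        tendsto_atTop_mono (fun n => by simp only [id]; omega) tendsto_id
      exact (hctop.comp h2).const_mul_atTop (by norm_num)
    refine squeeze_zero (fun n => (hzpos n).le) (fun n => ?_) (h1.const_div_atTop 1)
    rw [le_div_iff₀ (by linarith [hc0 (K + 1 + n + e)])]
    exact hzle n
  refine ⟨a, hapos, strictMono_nat_of_lt_succ fun k => ?_, hbound _ ?_,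
    exists_rat_consecutiveSum hapos hzlim (fun n => (hzpos n).le) hz0 hz⟩
  · by_cases hk : k + 1 < K + 1 + e
    · rw [ha0 k (by omega), ha0 (k + 1) hk]
      have : ⌈4 * c k⌉₊ ≤ ⌈4 * c (k + 1)⌉₊ := Nat.ceil_mono (by linarith [hcmono k])
      change ⌈4 * c k⌉₊ + k < ⌈4 * c (k + 1)⌉₊ + (k + 1)
      omega
    -- From `K` on, `16 * c k < 4 * c (k + 1)` separates the ranges of successive terms.
    · have h1 := hahigh k (by omega)
      have h2 := halow (k + 1)
      have h3 : 4 * c k < c (k + 1) := (hK k (by omega)).2.2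
      have : (a k : ℝ) < a (k + 1) := by linarith
      exact_mod_cast this
  · filter_upwards [eventually_ge_atTop K] with n hn
    exact ⟨halow n, hahigh n hn⟩

/-! ### The case `d = 2` and the main theorem -/

theorem sq_eq_add_one_iff {x : ℝ} (hx : 0 < x) :
    x ^ 2 = x ^ (2 - 1) + 1 ↔ x = (1 + Real.sqrt 5) / 2 := by
  have h5 : Real.sqrt 5 ^ 2 = 5 := Real.sq_sqrt (by norm_num)
  have h0 : 0 ≤ Real.sqrt 5 := Real.sqrt_nonneg 5
  have h1 : 1 < Real.sqrt 5 := by nlinarith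
  norm_num
  constructor
  · intro h
    have h2 : (x - (1 + Real.sqrt 5) / 2) * (x - (1 - Real.sqrt 5) / 2) = 0 := by nlinarith
    rcases mul_eq_zero.1 h2 with h3 | h3 <;> linarith
  · rintro rfl
    nlinarith

/-- Raising `c ≤ a_n ^ (1 / 2 ^ n)` to the power `(2 / ψ) ^ n`, which is unbounded, replaces `2` by
`ψ`. -/
theorem tendsto_rpow_atTop_of_one_lt_liminf {ψ : ℝ} (hψ0 : 0 < ψ) (hψ2 : ψ < 2) {a : ℕ → ℕ}
    (h : 1 < liminf (fun n : ℕ => (((a n : ℝ) ^ ((1 : ℝ) / 2 ^ n) : ℝ) : EReal)) atTop) :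
    Tendsto (fun n : ℕ => (a n : ℝ) ^ ((1 : ℝ) / ψ ^ n)) atTop atTop := by
  obtain ⟨c, hc1, hc2⟩ := EReal.lt_iff_exists_real_btwn.1 h
  have hc : 1 < c := by exact_mod_cast hc1
  have hlim : Tendsto (fun n : ℕ => c ^ ((2 / ψ) ^ n)) atTop atTop :=
    (tendsto_rpow_atTop_of_base_gt_one c hc).comp
      (tendsto_pow_atTop_atTop_of_one_lt ((one_lt_div hψ0).2 hψ2))
  refine tendsto_atTop_mono' _ ?_ hlim
  filter_upwards [eventually_lt_of_lt_liminf hc2] with n hn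
  have hn' : c ≤ (a n : ℝ) ^ ((1 : ℝ) / 2 ^ n) := by exact_mod_cast hn.le
  have h1 := Real.rpow_le_rpow (by linarith) hn' (show 0 ≤ (2 / ψ) ^ n by positivity)
  rw [← Real.rpow_mul (by positivity),
    show (1 : ℝ) / 2 ^ n * (2 / ψ) ^ n = 1 / ψ ^ n by rw [div_pow]; field_simp] at h1
  exact h1

theorem mainTheorem1 :
    (∀ d : ℕ, 1 ≤ d →
      (∃! x : ℝ, 0 < x ∧ x ^ d = x ^ (d - 1) + 1) ∧
      ∀ ψ : ℝ, 0 < ψ → ψ ^ d = ψ ^ (d - 1) + 1 →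
        1 < ψ ∧
        (∀ a : ℕ → ℕ, (∀ n, 1 ≤ n → 0 < a n) → MonotoneOn a (Set.Ici 1) →
          Tendsto (fun n : ℕ => (a n : ℝ) ^ ((1 : ℝ) / ψ ^ n)) atTop atTop →
          ∃ S : ℝ, ConsecutiveSum d a S ∧ Irrational S) ∧
        (∀ C : ℝ, 1 < C →
          ∃ a : ℕ → ℕ, (∀ n, 1 ≤ n → 0 < a n) ∧ StrictMonoOn a (Set.Ici 1) ∧
            Tendsto (fun n : ℕ => (a n : ℝ) ^ ((1 : ℝ) / ψ ^ n)) atTop (𝓝 C) ∧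
            ∃ q : ℚ, ConsecutiveSum d a (q : ℝ))) ∧
    (∀ x : ℝ, 0 < x → (x ^ 2 = x ^ (2 - 1) + 1 ↔ x = (1 + Real.sqrt 5) / 2)) ∧
    (∀ a : ℕ → ℕ, (∀ n, 1 ≤ n → 0 < a n) → StrictMonoOn a (Set.Ici 1) →
      1 < liminf (fun n : ℕ => (((a n : ℝ) ^ ((1 : ℝ) / 2 ^ n) : ℝ) : EReal)) atTop →
      ∃ S : ℝ, ConsecutiveSum 2 a S ∧ Irrational S) := by
  refine ⟨fun d hd => ?_, fun x hx => sq_eq_add_one_iff hx, fun a ha hm h => ?_⟩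
  · obtain ⟨e, rfl⟩ : ∃ e, d = e + 1 := ⟨d - 1, by omega⟩
    rw [Nat.add_sub_cancel]
    refine ⟨existsUnique_root e, fun ψ hψ0 hψ => ?_⟩
    have hψ1 := one_lt_of_pow_mul_sub_one hψ0 ((pow_mul_sub_one_eq_one_iff e ψ).1 hψ)
    refine ⟨hψ1, fun a ha hm h => exists_irrational_consecutiveSum hψ1 hψ ha hm h, fun C hC => ?_⟩
    obtain ⟨a, ha, hmono, hlim, hsum⟩ := exists_rat_consecutiveSum_of_one_lt hψ1 hψ hC
    exact ⟨a, fun n _ => ha n, hmono.strictMonoOn _, hlim, hsum⟩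
  · obtain ⟨ψ, ⟨hψ0, hψ⟩, -⟩ := existsUnique_root 1
    have hψ1 := one_lt_of_pow_mul_sub_one hψ0 ((pow_mul_sub_one_eq_one_iff 1 ψ).1 hψ)
    have hψ2 : ψ < 2 := by
      rw [pow_one, pow_two] at hψ
      by_contra! hcon
      nlinarith
    exact exists_irrational_consecutiveSum hψ1 hψ ha hm.monotoneOn
      (tendsto_rpow_atTop_of_one_lt_liminf hψ0 hψ2 h)
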